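/- For a finite simple graph $G$ let $Z_G(\lambda)=\sum_{k\ge 0} i_k(G)\lambda^k$ be its independence polynomial, where $i_k(G)$ is the number of independent sets of size $k$ in $G$. (a) If $\operatorname{Re}\lambda\ge 0$ and $|\lambda|\le 1$, then $Z_G(\lambda)\ne 0$ for every finite graph $G$ of maximum degree at most $3$. (b) Let $\Delta\ge 3$ and $\tau=\tan\left(\frac{\pi}{2(\Delta-1)}\right)$. Put $$D_1=\{\lambda\in\mathbb C : \operatorname{Re}\lambda\ge 0,\ |\lambda|\le \tfrac78\tau\},\qquad D_2=\{\lambda\in\mathbb C : \operatorname{Re}\lambda\ge 0,\ |\lambda|\le \tau\},$$ and let $D_{PR}=\bigcup_{\varepsilon\ge 0}D_\varepsilon$ (the Peters–Regts region), where $$D_\varepsilon=\left\{\lambda\in\mathbb C : |\lambda|\le\tan\left(\frac{\pi}{(2+\varepsilon)(\Delta-1)}\right),\ |\arg\lambda|\le\frac{\varepsilon\pi}{2(2+\varepsilon)}\right\}$$ (with $\arg\lambda\in(-\pi,\pi]$ and the convention $\arg 0=0$). Then there is a closed region $D\subseteq\mathbb C$, meaning that the interior of $D$ is nonempty and connected and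 $D$ is the closure of its interior, such that 1. $Z_G(\lambda)\neq 0$ for every $\lambda\in D$ and every finite graph $G$ of maximum degree at most $\Delta$; 2. $D_1\subseteq D\subseteq D_2$; 3. $D_{PR}\subsetneq D$; 4. $\tau,\ i\tau,\ -i\tau\in D$. -/

import Mathlib

/-- The independence polynomial `Z_G`, as a function of `x : ℂ`: the sum over `k` of the number of
independent sets of `G` of size `k` times `x ^ k`. -/
noncomputable def independencePolynomial {V : Type*} [Fintype V] [DecidableEq V]
    (G : SimpleGraph V) [DecidableRel G.Adj] (x : ℂ) : ℂ :=
  ∑ k ∈ Finset.range (Fintype.card V + 1), ((G.indepSetFinset k).card : ℂ) * x ^ k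

/-- The closed right half disk of radius `r` around the origin. -/
def rightHalfDisk (r : ℝ) : Set ℂ :=
  {z : ℂ | 0 ≤ z.re ∧ ‖z‖ ≤ r}

/-- The number `tan (π / (2 (Δ - 1)))`. -/
noncomputable def tanRadius (Δ : ℕ) : ℝ :=
  Real.tan (Real.pi / (2 * ((Δ : ℝ) - 1)))

/-- The Peters-Regts sector with parameter `ε`. -/
def petersRegtsSector (Δ : ℕ) (ε : ℝ) : Set ℂ :=
  {z : ℂ | ‖z‖ ≤ Real.tan (Real.pi / ((2 + ε) * ((Δ : ℝ) - 1))) ∧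
    |Complex.arg z| ≤ ε * Real.pi / (2 * (2 + ε))}

/-- The Peters-Regts region: the union of the sectors over all `ε ≥ 0`. -/
def petersRegtsRegion (Δ : ℕ) : Set ℂ :=
  ⋃ ε : {ε : ℝ // 0 ≤ ε}, petersRegtsSector Δ ε

/-! Put `n = Δ - 1`. Deleting the neighbours of a vertex one at a time expresses its occupation
ratio as `R = z ∏ (1 + Rᵢ)⁻¹`, with at most `n` factors when the vertex has degree at most `n`. If a
set `U` in the closed right half plane is invariant under this recursion, induction on the vertex
set gives `Z ≠ 0` (`ratioBound_of_invariant`).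

By conjugation let `z = r e^{iθ}` with `θ = |arg z|`, and take for `U` the sector of radius `r` with
angles in `[-φ, π/2]`. On it `(1 + w)⁻¹` has norm at most `1` and angle in `[-β, α]`, where `β =
arctan r` and `α = arg (1 + r e^{iφ})`. So `U` is invariant as soon as `nβ - θ ≤ φ` and `θ + nα ≤
π/2`.

Taking `φ = nβ - θ` when this is nonnegative removes `θ`: what remains is `n (β + α) ≤ π/2 + φ`. For
`n = 2` and `r ≤ 1` this is `β ≤ π/4` and `α ≤ φ/2`. For `r ≤ (7/8) τ` it is `arctan_add_arctan_le`,
an inequality integrated from its derivative. The choice `φ = π/2` covers `θ + nβ ≤ π/2`, which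
contains the Peters–Regts region and `τ`; the choice `φ = 0` covers `nβ ≤ θ`, which contains `±iτ`.
The region `D` is the union of these two pieces with the half disk. -/

/-! ### Trigonometric and arctangent inequalities. -/

/-- The chord bound for `sin / cos` on `[0, π / 4]`. -/
theorem sin_le_mul_cos_of_mem_Icc {h : ℝ} (hh : h ∈ Set.Icc 0 (Real.pi / 4)) :
    Real.sin h ≤ 4 / Real.pi * h * Real.cos h := by
  have hpi := Real.pi_pos
  have hpi4 := Real.pi_lt_four
  set k : ℝ := 4 / Real.pi with hk
  have hk1 : 1 ≤ k := by rw [hk, le_div_iff₀ hpi]; linarith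
  have hkpi : k * (Real.pi / 4) = 1 := by rw [hk]; field_simp
  have hder : ∀ x : ℝ, HasDerivAt (fun x => k * x * Real.cos x - Real.sin x)
      (k * Real.cos x - k * (x * Real.sin x) - Real.cos x) x := by
    intro x
    have := (((hasDerivAt_id x).const_mul k).mul (Real.hasDerivAt_cos x)).sub (Real.hasDerivAt_sin x)
    refine HasDerivAt.congr_deriv this ?_
    simp only [id]
    ring
  -- The difference of the two sides is concave and vanishes at both endpoints, so it is nonnegative
  -- between them.
  have hconc : ConcaveOn ℝ (Set.Icc 0 (Real.pi / 4))
      (fun x => k * x * Real.cos x - Real.sin x) := by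
    apply AntitoneOn.concaveOn_of_deriv (convex_Icc _ _)
    · fun_prop
    · fun_prop
    · intro x hx y hy hxy
      rw [interior_Icc] at hx hy
      rw [(hder x).deriv, (hder y).deriv]
      have hc : Real.cos y ≤ Real.cos x :=
        Real.cos_le_cos_of_nonneg_of_le_pi hx.1.le (by linarith [hy.2]) hxy
      have hs : Real.sin x ≤ Real.sin y :=
        Real.sin_le_sin_of_le_of_le_pi_div_two (by linarith [hx.1]) (by linarith [hy.2]) hxy
      have hs0 : 0 ≤ Real.sin x := Real.sin_nonneg_of_nonneg_of_le_pi hx.1.le (by linarith [hx.2])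
      have h1 : x * Real.sin x ≤ y * Real.sin y := mul_le_mul hxy hs hs0 hy.1.le
      nlinarith
  have := hconc.min_le_of_mem_Icc (Set.left_mem_Icc.2 (by positivity))
    (Set.right_mem_Icc.2 (by positivity)) hh
  simp only [hkpi, mul_zero, zero_mul, Real.sin_zero, Real.cos_pi_div_four,
    Real.sin_pi_div_four, one_mul, sub_self, min_self] at this
  linarith

/-- The chord bound at `φ / 2`, since `sin φ / (1 + cos φ) = tan (φ / 2)`. -/
theorem sin_le_mul_one_add_cos {φ : ℝ} (hφ : φ ∈ Set.Icc 0 (Real.pi / 2)) :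
    Real.sin φ ≤ 2 * φ / Real.pi * (1 + Real.cos φ) := by
  have h := sin_le_mul_cos_of_mem_Icc (h := φ / 2) ⟨by linarith [hφ.1], by linarith [hφ.2]⟩
  have hc : 0 ≤ Real.cos (φ / 2) := Real.cos_nonneg_of_neg_pi_div_two_le_of_le
    (by linarith [hφ.1, Real.pi_pos]) (by linarith [hφ.2, Real.pi_pos])
  have e : φ = 2 * (φ / 2) := by ring
  have hs : Real.sin φ = 2 * Real.sin (φ / 2) * Real.cos (φ / 2) := by
    conv_lhs => rw [e, Real.sin_two_mul]
  have hcos : Real.cos φ = 2 * Real.cos (φ / 2) ^ 2 - 1 := by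
    conv_lhs => rw [e, Real.cos_two_mul]
  rw [hs, hcos]
  calc 2 * Real.sin (φ / 2) * Real.cos (φ / 2)
      ≤ 2 * (4 / Real.pi * (φ / 2) * Real.cos (φ / 2)) * Real.cos (φ / 2) := by gcongr
    _ = _ := by ring

/-- This is the tangent line of `√2 sin` at `π/4`, shifted to the origin. For `x < 0` the quadratic
drop of the cosine outweighs the cubic error of the sine. -/
theorem sin_add_cos_le_one_add {x : ℝ} (hx : -(1 / 2) ≤ x) :
    Real.sin x + Real.cos x ≤ 1 + x := by
  rcases le_total 0 x with h | h
  · linarith [Real.sin_le h, Real.cos_le_one x]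
  · rcases h.eq_or_lt with rfl | h
    · simp
    have h1 := Real.sin_gt_sub_cube (x := -x) (by linarith)
    have h2 := Real.cos_le_one_sub_mul_cos_sq (x := x)
      (by rw [abs_of_neg h]; linarith [Real.pi_gt_three])
    have h3 : (1 / 6 : ℝ) ≤ 2 / Real.pi ^ 2 := by
      rw [div_le_div_iff₀ (by norm_num) (by positivity)]
      nlinarith [Real.pi_lt_d2, Real.pi_pos]
    rw [Real.sin_neg] at h1
    nlinarith [mul_nonneg (sub_nonneg.2 h3) (sq_nonneg x), mul_nonneg (sq_nonneg x)
      (by linarith : 0 ≤ 1 + x)]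

/-- This fixes the constant: `(1 + 2φ/π) / (1 + sin φ)` has minimum about `0.8786` on `[0, π/2]`,
just above `7/8`. The sine is bounded by its tangent at `0` up to `φ = 1/2` and by its tangent at
`π/4` beyond. -/
theorem seven_eighths_mul_one_add_sin_le {φ : ℝ} (hφ : 0 ≤ φ) :
    7 / 8 * (1 + Real.sin φ) ≤ 1 + 2 * φ / Real.pi := by
  have hk : 0.63661 * φ ≤ 2 * φ / Real.pi := by
    rw [le_div_iff₀ Real.pi_pos]
    nlinarith [Real.pi_lt_d4]
  rcases le_total φ (1 / 2) with h | h
  · linarith [Real.sin_le hφ]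
  · have h1 := sin_add_cos_le_one_add (x := φ - Real.pi / 4) (by linarith [Real.pi_lt_four])
    have h2 : Real.sin φ = √2 / 2 * (Real.sin (φ - Real.pi / 4) + Real.cos (φ - Real.pi / 4)) := by
      conv_lhs => rw [← sub_add_cancel φ (Real.pi / 4), Real.sin_add, Real.cos_pi_div_four,
        Real.sin_pi_div_four]
      ring
    have h3 : √2 ≤ 1.41422 := Real.sqrt_le_iff.2 ⟨by norm_num, by norm_num⟩
    have h4 : Real.sin φ ≤ √2 / 2 * (1 + (φ - Real.pi / 4)) := by rw [h2]; gcongr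
    have h5 : √2 / 2 * (1 + (φ - Real.pi / 4)) ≤ 0.70711 * (1 + (φ - Real.pi / 4)) := by
      apply mul_le_mul_of_nonneg_right (by linarith)
      linarith [Real.pi_lt_four]
    linarith [Real.pi_gt_d4]

/-- The bound on the `t`-derivative of `arctan (c t) + arg (1 + c t e^{iφ})`. -/
theorem deriv_arctan_sum_le {c t φ : ℝ} (hc0 : 0 ≤ c) (hc1 : c ≤ 1) (ht0 : 0 ≤ t) (ht1 : t ≤ 1)
    (hφ : φ ∈ Set.Icc 0 (Real.pi / 2)) (hcφ : c * (1 + Real.sin φ) ≤ 1 + 2 * φ / Real.pi) :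
    c / (1 + c ^ 2 * t ^ 2) + c * Real.sin φ / (1 + 2 * c * t * Real.cos φ + c ^ 2 * t ^ 2) ≤
      (1 + 2 * φ / Real.pi) / (1 + t ^ 2) := by
  have hpi := Real.pi_pos
  have hs : 0 ≤ Real.sin φ := Real.sin_nonneg_of_nonneg_of_le_pi hφ.1 (by linarith [hφ.2])
  have hcos : 0 ≤ Real.cos φ := Real.cos_nonneg_of_neg_pi_div_two_le_of_le
    (by linarith [hφ.1]) hφ.2
  have hm := sin_le_mul_one_add_cos hφ
  set m : ℝ := 2 * φ / Real.pi
  have hm0 : 0 ≤ m := div_nonneg (by linarith [hφ.1]) hpi.le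
  set S := Real.sin φ
  set C := Real.cos φ
  have hq : 0 < 1 + c ^ 2 * t ^ 2 := by positivity
  -- With `p` both denominators share the factor `1 + c²t²`, and the claim becomes polynomial in `p
  -- ∈ [0, 1]`.
  set p : ℝ := 2 * c * t / (1 + c ^ 2 * t ^ 2) with hp
  have hp0 : 0 ≤ p := by positivity
  have hp1 : p ≤ 1 := by
    rw [hp, div_le_one hq]; nlinarith [sq_nonneg (1 - c * t)]
  have hk : c * (1 + t ^ 2) / (1 + c ^ 2 * t ^ 2) ≤ c + (1 - c) * p := by
    have : c + (1 - c) * p = (c * (1 + c ^ 2 * t ^ 2) + (1 - c) * (2 * c * t)) /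
        (1 + c ^ 2 * t ^ 2) := by rw [hp]; field_simp
    rw [this]
    apply div_le_div_of_nonneg_right _ hq.le
    have : 0 ≤ c * (1 - c) * t * (2 - (1 + c) * t) := by
      apply mul_nonneg (mul_nonneg (mul_nonneg hc0 (by linarith)) ht0)
      nlinarith
    nlinarith
  -- The difference of the sides is concave in `p`: it is the linear interpolation of its values at
  -- `p = 0` (`hcφ`) and `p = 1` (`hm`), plus `p (1 - p) (1 - c) cos φ`.
  have key : (c + (1 - c) * p) * (1 + p * C + S) ≤ (1 + m) * (1 + p * C) := by
    have e1 : 0 ≤ (1 - p) * (1 + m - c * (1 + S)) := mul_nonneg (by linarith) (by linarith)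
    have e2 : 0 ≤ p * (m * (1 + C) - S) := mul_nonneg hp0 (by linarith)
    have e3 : 0 ≤ p * (1 - p) * ((1 - c) * C) :=
      mul_nonneg (mul_nonneg hp0 (by linarith)) (mul_nonneg (by linarith) hcos)
    nlinarith
  have hpC : 0 < 1 + p * C := by positivity
  have hden : 1 + 2 * c * t * C + c ^ 2 * t ^ 2 = (1 + c ^ 2 * t ^ 2) * (1 + p * C) := by
    rw [hp]; field_simp
    ring
  rw [le_div_iff₀ (by positivity), hden]
  calc (c / (1 + c ^ 2 * t ^ 2) + c * S / ((1 + c ^ 2 * t ^ 2) * (1 + p * C))) * (1 + t ^ 2)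
      = c * (1 + t ^ 2) / (1 + c ^ 2 * t ^ 2) * ((1 + p * C + S) / (1 + p * C)) := by
        field_simp
    _ ≤ (c + (1 - c) * p) * ((1 + p * C + S) / (1 + p * C)) := by gcongr
    _ ≤ 1 + m := by
        rw [← mul_div_assoc, div_le_iff₀ hpC]
        exact key

/-- The second arctangent is `arg (1 + c t e^{iφ})`. Both sides vanish at `t = 0`, and
`deriv_arctan_sum_le` compares their derivatives. -/
theorem arctan_add_arctan_le {c t φ : ℝ} (hc0 : 0 ≤ c) (hc1 : c ≤ 1) (ht0 : 0 ≤ t) (ht1 : t ≤ 1)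
    (hφ : φ ∈ Set.Icc 0 (Real.pi / 2)) (hcφ : c * (1 + Real.sin φ) ≤ 1 + 2 * φ / Real.pi) :
    Real.arctan (c * t) + Real.arctan (c * t * Real.sin φ / (1 + c * t * Real.cos φ)) ≤
      (1 + 2 * φ / Real.pi) * Real.arctan t := by
  have hcos : 0 ≤ Real.cos φ := Real.cos_nonneg_of_neg_pi_div_two_le_of_le
    (by linarith [hφ.1, Real.pi_pos]) hφ.2
  let f : ℝ → ℝ := fun x => (1 + 2 * φ / Real.pi) * Real.arctan x - (Real.arctan (c * x) +
    Real.arctan (c * x * Real.sin φ / (1 + c * x * Real.cos φ)))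
  have hder : ∀ x : ℝ, 0 ≤ x → HasDerivAt f ((1 + 2 * φ / Real.pi) / (1 + x ^ 2) -
      (c / (1 + c ^ 2 * x ^ 2) +
        c * Real.sin φ / (1 + 2 * c * x * Real.cos φ + c ^ 2 * x ^ 2))) x := by
    intro x hx
    have hd : 0 < 1 + c * x * Real.cos φ := by positivity
    have h1 : HasDerivAt (fun x : ℝ => c * x) c x := by
      simpa using (hasDerivAt_id x).const_mul c
    have h2 := (h1.mul_const (Real.sin φ)).div ((h1.mul_const (Real.cos φ)).const_add 1) hd.ne'
    have h := ((Real.hasDerivAt_arctan x).const_mul (1 + 2 * φ / Real.pi)).sub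
      (h1.arctan.add h2.arctan)
    refine HasDerivAt.congr_deriv h ?_
    have hsc := Real.sin_sq_add_cos_sq φ
    have hD : 1 + 2 * c * x * Real.cos φ + c ^ 2 * x ^ 2 =
        (1 + c * x * Real.cos φ) ^ 2 + (c * x * Real.sin φ) ^ 2 := by
      linear_combination (-(c * x) ^ 2) * hsc
    rw [hD]
    have hD0 : 0 < (1 + c * x * Real.cos φ) ^ 2 + (c * x * Real.sin φ) ^ 2 := by positivity
    symm
    congr 1
    · ring
    · simp only [Pi.div_apply]
      have e : 1 + (c * x * Real.sin φ / (1 + c * x * Real.cos φ)) ^ 2 =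
        ((1 + c * x * Real.cos φ) ^ 2 + (c * x * Real.sin φ) ^ 2) /
          (1 + c * x * Real.cos φ) ^ 2 := by field_simp
      rw [e]
      field_simp
      ring
  have hmono : MonotoneOn f (Set.Icc 0 1) := by
    apply monotoneOn_of_deriv_nonneg (convex_Icc _ _)
    · exact fun x hx => (hder x hx.1).continuousAt.continuousWithinAt
    · intro x hx
      rw [interior_Icc] at hx
      exact (hder x hx.1.le).differentiableAt.differentiableWithinAt
    · intro x hx
      rw [interior_Icc] at hx
      rw [(hder x hx.1.le).deriv, sub_nonneg]
      exact deriv_arctan_sum_le hc0 hc1 hx.1.le hx.2.le hφ hcφ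
  have := hmono (Set.left_mem_Icc.2 zero_le_one) ⟨ht0, ht1⟩ ht0
  simp only [f, mul_zero, zero_mul, zero_div, Real.arctan_zero, add_zero, sub_zero] at this
  linarith

/-! ### Polar sectors and the map `w ↦ (1 + w)⁻¹`. -/

/-- The sector of complex numbers `s * exp (i ψ)` with `0 ≤ s ≤ r` and `a ≤ ψ ≤ b`. -/
def polarSector (r a b : ℝ) : Set ℂ :=
  {z : ℂ | ∃ s ψ : ℝ, 0 ≤ s ∧ s ≤ r ∧ a ≤ ψ ∧ ψ ≤ b ∧ z = s * Complex.exp (ψ * Complex.I)}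

theorem polarSector_mono {r a b a' b' : ℝ} (ha : a' ≤ a) (hb : b ≤ b') :
    polarSector r a b ⊆ polarSector r a' b' := by
  rintro z ⟨s, ψ, h0, h1, h2, h3, rfl⟩
  exact ⟨s, ψ, h0, h1, ha.trans h2, h3.trans hb, rfl⟩

/-- Angles are real witnesses, not values of `arg`, so they add without reduction modulo `2π`. -/
theorem mul_mem_polarSector {r r' a b a' b' : ℝ} {z w : ℂ} (hz : z ∈ polarSector r a b)
    (hw : w ∈ polarSector r' a' b') : z * w ∈ polarSector (r * r') (a + a') (b + b') := by
  obtain ⟨s, ψ, h0, h1, h2, h3, rfl⟩ := hz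
  obtain ⟨s', ψ', h0', h1', h2', h3', rfl⟩ := hw
  refine ⟨s * s', ψ + ψ', by positivity, mul_le_mul h1 h1' h0' (h0.trans h1), by linarith,
    by linarith, ?_⟩
  push_cast
  rw [add_mul, Complex.exp_add]
  ring

theorem multiset_prod_mem_polarSector {a b : ℝ} (s : Multiset ℂ)
    (hs : ∀ x ∈ s, x ∈ polarSector 1 a b) :
    s.prod ∈ polarSector 1 (s.card * a) (s.card * b) := by
  induction s using Multiset.induction with
  | empty => exact ⟨1, 0, by simp⟩
  | cons x s ih =>
    have h := mul_mem_polarSector (hs x (by simp)) (ih fun y hy => hs y (by simp [hy]))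
    rw [Multiset.prod_cons, Multiset.card_cons]
    convert h using 1
    push_cast
    ring_nf

theorem re_nonneg_of_mem_polarSector {r a b : ℝ} {z : ℂ} (ha : -(Real.pi / 2) ≤ a)
    (hb : b ≤ Real.pi / 2) (hz : z ∈ polarSector r a b) : 0 ≤ z.re := by
  obtain ⟨s, ψ, h0, h1, h2, h3, rfl⟩ := hz
  rw [Complex.re_ofReal_mul, Complex.exp_ofReal_mul_I_re]
  exact mul_nonneg h0 (Real.cos_nonneg_of_neg_pi_div_two_le_of_le (ha.trans h2) (h3.trans hb))

/-- Since `Re z ≥ 0`, the norm of `1 + z` is at least `1`. Its argument is extremal at the corners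
`r i` and `r e^{-iφ}` of the sector. -/
theorem inv_one_add_mem_polarSector {r φ : ℝ} (hφ : φ ∈ Set.Icc 0 (Real.pi / 2)) {z : ℂ}
    (hz : z ∈ polarSector r (-φ) (Real.pi / 2)) :
    (1 + z)⁻¹ ∈ polarSector 1 (-Real.arctan r)
      (Real.arctan (r * Real.sin φ / (1 + r * Real.cos φ))) := by
  have hpi := Real.pi_pos
  have hre := re_nonneg_of_mem_polarSector (by linarith [hφ.2]) le_rfl hz
  obtain ⟨s, ψ, h0, h1, h2, h3, rfl⟩ := hz
  set z : ℂ := s * Complex.exp (ψ * Complex.I) with hzdef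
  have hr : 0 ≤ r := h0.trans h1
  have hC : 0 ≤ Real.cos φ := Real.cos_nonneg_of_neg_pi_div_two_le_of_le (by linarith [hφ.1]) hφ.2
  have hS : 0 ≤ Real.sin φ := Real.sin_nonneg_of_nonneg_of_le_pi hφ.1 (by linarith [hφ.2])
  have hc : 0 ≤ Real.cos ψ :=
    Real.cos_nonneg_of_neg_pi_div_two_le_of_le (by linarith [hφ.2]) h3
  have hzre : z.re = s * Real.cos ψ := by
    rw [hzdef, Complex.re_ofReal_mul, Complex.exp_ofReal_mul_I_re]
  have hzim : z.im = s * Real.sin ψ := by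
    rw [hzdef, Complex.im_ofReal_mul, Complex.exp_ofReal_mul_I_im]
  have hwre : (1 + z).re = 1 + s * Real.cos ψ := by simp [hzre]
  have hwim : (1 + z).im = s * Real.sin ψ := by simp [hzim]
  have hden : 0 < 1 + s * Real.cos ψ := by positivity
  have hden' : 0 < 1 + r * Real.cos φ := by positivity
  have harg : Complex.arg (1 + z) =
      Real.arctan (s * Real.sin ψ / (1 + s * Real.cos ψ)) := by
    have h : |Complex.arg (1 + z)| < Real.pi / 2 :=
      Complex.abs_arg_lt_pi_div_two_iff.2 (Or.inl (by rw [hwre]; exact hden))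
    rw [abs_lt] at h
    rw [← hwre, ← hwim, ← Complex.tan_arg, Real.arctan_tan h.1 h.2]
  have hnorm : 1 ≤ ‖1 + z‖ := by
    refine le_trans ?_ (Complex.re_le_norm _)
    rw [hwre]
    linarith [mul_nonneg h0 hc]
  refine ⟨‖1 + z‖⁻¹, -Complex.arg (1 + z), by positivity, inv_le_one_of_one_le₀ hnorm, ?_, ?_, ?_⟩
  · rw [neg_le_neg_iff, harg, Real.arctan_le_arctan_iff, div_le_iff₀ hden]
    have := Real.sin_le_one ψ
    have := mul_nonneg hr (mul_nonneg h0 hc)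
    nlinarith
  · rw [harg, ← Real.arctan_neg, Real.arctan_le_arctan_iff, ← neg_div,
      div_le_div_iff₀ hden hden']
    have h4 : -(s * Real.sin ψ) ≤ r * Real.sin φ := by
      rcases le_total 0 ψ with h | h
      · have := Real.sin_nonneg_of_nonneg_of_le_pi h (by linarith)
        have := mul_nonneg h0 this
        have := mul_nonneg hr hS
        linarith
      · have h5 : Real.sin (-ψ) ≤ Real.sin φ :=
          Real.sin_le_sin_of_le_of_le_pi_div_two (by linarith) hφ.2 (by linarith)
        rw [Real.sin_neg] at h5
        nlinarith [mul_le_mul_of_nonneg_left h5 h0, mul_le_mul_of_nonneg_right h1 hS]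
    -- After cross-multiplication, what `h4` leaves over is `r s sin (φ + ψ) ≥ 0`.
    have h6 : 0 ≤ Real.sin (φ + ψ) :=
      Real.sin_nonneg_of_nonneg_of_le_pi (by linarith) (by linarith [hφ.2])
    rw [Real.sin_add] at h6
    nlinarith [mul_nonneg (mul_nonneg hr h0) h6]
  · conv_lhs => rw [← Complex.norm_mul_exp_arg_mul_I (1 + z)]
    rw [mul_inv, ← Complex.exp_neg]
    push_cast
    ring_nf

/-! ### The hard-core recursion on vertex subsets. -/

section Graph

variable {V : Type*} [DecidableEq V] (G : SimpleGraph V)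

open Classical in
/-- The independence polynomial of the subgraph of `G` induced on `S`. -/
noncomputable def indepSum (z : ℂ) (S : Finset V) : ℂ :=
  ∑ I ∈ S.powerset, if G.IsIndepSet (I : Set V) then z ^ I.card else 0

theorem independencePolynomial_eq_indepSum [Fintype V] [DecidableRel G.Adj] (z : ℂ) :
    independencePolynomial G z = indepSum G z Finset.univ := by
  classical
  unfold independencePolynomial indepSum
  have h : (∑ I : Finset V, if G.IsIndepSet (I : Set V) then z ^ I.card else 0) =
      ∑ I ∈ Finset.univ.filter (fun I : Finset V => G.IsIndepSet (I : Set V)), z ^ I.card := by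
    rw [Finset.sum_filter]
  rw [Finset.powerset_univ]
  convert h.symm using 1
  swap
  · congr!
  rw [← Finset.sum_fiberwise_of_maps_to (t := Finset.range (Fintype.card V + 1))
      (g := fun I : Finset V => I.card)]
  · refine Finset.sum_congr rfl fun k _ => ?_
    rw [Finset.sum_congr rfl (g := fun _ => z ^ k), Finset.sum_const, nsmul_eq_mul]
    · congr 3
      ext I
      simp [SimpleGraph.isNIndepSet_iff]
    · intro I hI
      rw [(Finset.mem_filter.1 hI).2]
  · intro I _
    exact Finset.mem_range.2 (Nat.lt_succ_of_le (Finset.card_le_univ I))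

theorem indepSum_empty (z : ℂ) : indepSum G z ∅ = 1 := by
  simp [indepSum, SimpleGraph.IsIndepSet]

open Classical in
theorem indepSum_eq_add {z : ℂ} {S : Finset V} {v : V} (hv : v ∈ S) :
    indepSum G z S = indepSum G z (S.erase v) +
      z * indepSum G z ({u ∈ S.erase v | ¬ G.Adj v u}) := by
  have hvW : v ∉ S.erase v := Finset.notMem_erase v S
  conv_lhs => rw [← Finset.insert_erase hv]
  unfold indepSum
  rw [Finset.sum_powerset_insert hvW, Finset.mul_sum]
  congr 1
  rw [← Finset.sum_subset (Finset.powerset_mono.2 (Finset.filter_subset (fun u => ¬ G.Adj v u) _))]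
  · refine Finset.sum_congr rfl fun I hI => ?_
    rw [Finset.mem_powerset] at hI
    have hvI : v ∉ I := fun h => hvW (Finset.mem_of_mem_filter _ (hI h))
    have hadj : ∀ u ∈ I, ¬ G.Adj v u := fun u hu => (Finset.mem_filter.1 (hI hu)).2
    have : G.IsIndepSet ((insert v I : Finset V) : Set V) ↔ G.IsIndepSet (I : Set V) := by
      rw [Finset.coe_insert, SimpleGraph.IsIndepSet, Set.pairwise_insert]
      refine ⟨fun h => h.1, fun h => ⟨h, fun u hu _ => ⟨hadj u hu, fun h' => hadj u hu h'.symm⟩⟩⟩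
    rw [Finset.card_insert_of_notMem hvI]
    simp only [this]
    split_ifs <;> ring
  · intro I hI hI'
    rw [Finset.mem_powerset] at hI hI'
    rw [if_neg]
    intro hind
    apply hI'
    intro u hu
    refine Finset.mem_filter.2 ⟨hI hu, fun hadj => ?_⟩
    exact hind (by simp) (by simp [hu]) hadj.ne hadj

open Classical in
/-- Vertices of low degree in `S` have an occupation ratio in `U`, and the partition function on
`S` does not vanish. -/
def RatioBound (z : ℂ) (n : ℕ) (U : Set ℂ) (S : Finset V) : Prop :=
  indepSum G z S ≠ 0 ∧ ∀ v ∈ S, ({u ∈ S.erase v | G.Adj v u} : Finset V).card ≤ n →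
    z * indepSum G z ({u ∈ S.erase v | ¬ G.Adj v u}) / indepSum G z (S.erase v) ∈ U

variable {G}

open Classical in
theorem RatioBound.exists_mul_eq {z : ℂ} {n : ℕ} {U : Set ℂ} {S : Finset V}
    (hS : RatioBound G z n U S) {u : V} (hu : u ∈ S)
    (hne : indepSum G z (S.erase u) ≠ 0)
    (hdeg : ({w ∈ S.erase u | G.Adj u w} : Finset V).card ≤ n) :
    ∃ x ∈ U, indepSum G z S = indepSum G z (S.erase u) * (1 + x) := by
  refine ⟨_, hS.2 u hu hdeg, ?_⟩
  rw [indepSum_eq_add G hu]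
  field_simp

open Classical in
-- The neighbour `v` outside `W` uses up one of the `n + 1` possible neighbours of `u`.
theorem card_neighbors_le_of_notMem {n : ℕ}
    (hG : ∀ (S : Finset V) (v : V), ({u ∈ S | G.Adj v u} : Finset V).card ≤ n + 1)
    {W : Finset V} {u v : V} (hv : v ∉ W) (huv : G.Adj u v) :
    ({w ∈ W | G.Adj u w} : Finset V).card ≤ n := by
  have h := hG (insert v W) u
  rw [Finset.filter_insert, if_pos huv, Finset.card_insert_of_notMem (by simp [hv])] at h
  omega

open Classical in
-- Telescoping: each `u ∈ T` has lost its neighbour `v`, so its ratio lies in `U`, and deleting it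
-- divides the partition function by `1 + x`.
theorem exists_multiset_indepSum_sdiff_eq {z : ℂ} {n : ℕ} {U : Set ℂ}
    (hG : ∀ (S : Finset V) (v : V), ({u ∈ S | G.Adj v u} : Finset V).card ≤ n + 1)
    {W : Finset V} {v : V} (hv : v ∉ W) (hW : ∀ W' ⊆ W, RatioBound G z n U W') (T : Finset V)
    (hT : T ⊆ W) (hadj : ∀ u ∈ T, G.Adj v u) :
    ∃ s : Multiset ℂ, s.card = T.card ∧ (∀ x ∈ s, x ∈ U) ∧
      indepSum G z (W \ T) = indepSum G z W * (s.map fun x => (1 + x)⁻¹).prod := by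
  induction T using Finset.induction with
  | empty => exact ⟨0, by simp⟩
  | insert u T hu ih =>
    obtain ⟨s, hs, hsU, hprod⟩ := ih (fun x hx => hT (by simp [hx]))
      (fun x hx => hadj x (by simp [hx]))
    have huW : u ∈ W \ T := Finset.mem_sdiff.2 ⟨hT (by simp), hu⟩
    have hne := (hW ((W \ T).erase u)
      ((Finset.erase_subset _ _).trans Finset.sdiff_subset)).1
    obtain ⟨x, hx, hmul⟩ := (hW (W \ T) Finset.sdiff_subset).exists_mul_eq huW hne
      (card_neighbors_le_of_notMem hG (v := v) (by simp [hv]) (hadj u (by simp)).symm)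
    have hx0 : 1 + x ≠ 0 := fun h =>
      (hW (W \ T) Finset.sdiff_subset).1 (by rw [hmul, h, mul_zero])
    refine ⟨x ::ₘ s, by simp [hs, hu], by simpa [hx] using hsU, ?_⟩
    have e : W \ insert u T = (W \ T).erase u := by
      ext y; simp only [Finset.mem_sdiff, Finset.mem_insert, Finset.mem_erase]; tauto
    rw [e, Multiset.map_cons, Multiset.prod_cons]
    have : indepSum G z ((W \ T).erase u) = indepSum G z (W \ T) * (1 + x)⁻¹ := by
      rw [hmul]; field_simp
    rw [this, hprod]
    ring

open Classical in
/-- Zero-freeness from a region `U` that is invariant under the hard-core recursion. -/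
theorem ratioBound_of_invariant {z : ℂ} {n : ℕ} {U : Set ℂ} (hre : ∀ x ∈ U, 0 ≤ x.re)
    (hU : ∀ s : Multiset ℂ, s.card ≤ n → (∀ x ∈ s, x ∈ U) →
      z * (s.map fun x => (1 + x)⁻¹).prod ∈ U)
    (hG : ∀ (S : Finset V) (v : V), ({u ∈ S | G.Adj v u} : Finset V).card ≤ n + 1)
    (S : Finset V) : RatioBound G z n U S := by
  induction S using Finset.strongInduction with
  | H S ih =>
    have hratio : ∀ v ∈ S, ({u ∈ S.erase v | G.Adj v u} : Finset V).card ≤ n →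
        z * indepSum G z ({u ∈ S.erase v | ¬ G.Adj v u}) / indepSum G z (S.erase v) ∈ U := by
      intro v hv hdeg
      have hW : ∀ W' ⊆ S.erase v, RatioBound G z n U W' := fun W' hW' =>
        ih W' (lt_of_le_of_lt hW' (Finset.erase_ssubset hv))
      obtain ⟨s, hs, hsU, hprod⟩ := exists_multiset_indepSum_sdiff_eq hG
        (Finset.notMem_erase v S) hW {u ∈ S.erase v | G.Adj v u} (Finset.filter_subset _ _)
        (fun u hu => (Finset.mem_filter.1 hu).2)
      have hne := (hW _ subset_rfl).1
      rw [Finset.filter_not, hprod]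
      convert hU s (hs.trans_le hdeg) hsU using 1
      field_simp
    refine ⟨?_, hratio⟩
    rcases S.eq_empty_or_nonempty with rfl | ⟨v, hv⟩
    · rw [indepSum_empty]; exact one_ne_zero
    have hW : ∀ W' ⊆ S.erase v, RatioBound G z n U W' := fun W' hW' =>
      ih W' (lt_of_le_of_lt hW' (Finset.erase_ssubset hv))
    have hne := (hW _ subset_rfl).1
    by_cases hdeg : ({u ∈ S.erase v | G.Adj v u} : Finset V).card ≤ n
    · have hx := hre _ (hratio v hv hdeg)
      intro h0
      rw [indepSum_eq_add G hv] at h0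
      rw [show z * indepSum G z ({u ∈ S.erase v | ¬ G.Adj v u}) = -indepSum G z (S.erase v) by
        linear_combination h0, neg_div, div_self hne] at hx
      norm_num at hx
    -- A vertex of full degree `n + 1` has no ratio bound. One neighbour `u` is split off, and the
    -- other at most `n` go through the recursion.
    · set T : Finset V := {u ∈ S.erase v | G.Adj v u} with hT
      obtain ⟨u, huT⟩ : T.Nonempty := by
        rw [← Finset.card_pos]; omega
      have hu := (Finset.mem_filter.1 huT)
      have hsub : (S.erase v).erase u ⊆ S.erase v := Finset.erase_subset _ _
      have hne' := (hW _ hsub).1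
      obtain ⟨x, hx, hmul⟩ := (hW _ subset_rfl).exists_mul_eq hu.1 hne'
        (card_neighbors_le_of_notMem hG (v := v) (by simp) hu.2.symm)
      obtain ⟨s, hs, hsU, hprod⟩ := exists_multiset_indepSum_sdiff_eq hG (v := v)
        (W := (S.erase v).erase u) (by simp) (fun W' h => hW W' (h.trans hsub)) (T.erase u)
        (Finset.erase_subset_erase _ (Finset.filter_subset _ _))
        (fun w hw => (Finset.mem_filter.1 (Finset.mem_of_mem_erase hw)).2)
      have hcard : s.card ≤ n := by
        rw [hs, Finset.card_erase_of_mem huT]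
        have : T.card ≤ n + 1 := hG (S.erase v) v
        omega
      have hy := hre _ (hU s hcard hsU)
      have e : ({w ∈ S.erase v | ¬ G.Adj v w} : Finset V) = (S.erase v).erase u \ T.erase u := by
        ext w
        simp only [hT, Finset.mem_filter, Finset.mem_sdiff, Finset.mem_erase]
        constructor
        · rintro ⟨h1, h2⟩
          exact ⟨⟨fun h => h2 (h ▸ hu.2), h1⟩, fun h => h2 h.2.2⟩
        · rintro ⟨⟨h1, h2⟩, h3⟩
          exact ⟨h2, fun h => h3 ⟨h1, h2, h⟩⟩
      rw [indepSum_eq_add G hv, e, hprod, hmul]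
      intro h0
      -- Divided by the partition function without `v` and `u`, the sum is `1 + x + y` with `x, y ∈
      -- U`, of real part at least `1`.
      have h1 : 1 + x + z * (s.map fun x => (1 + x)⁻¹).prod = 0 := by
        apply mul_left_cancel₀ hne'
        linear_combination h0
      have h2 := congrArg Complex.re h1
      simp only [Complex.add_re, Complex.one_re, Complex.zero_re] at h2
      linarith [hre x hx]

/-- The zero-freeness criterion in polar form. -/
theorem independencePolynomial_ne_zero_of_angles [Fintype V] [DecidableRel G.Adj] {n : ℕ}
    (hG : G.maxDegree ≤ n + 1) {r θ φ : ℝ} (hr : 0 ≤ r) (hφ : φ ∈ Set.Icc 0 (Real.pi / 2))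
    (h1 : n * Real.arctan r - θ ≤ φ)
    (h2 : θ + n * Real.arctan (r * Real.sin φ / (1 + r * Real.cos φ)) ≤ Real.pi / 2) :
    independencePolynomial G (r * Complex.exp (θ * Complex.I)) ≠ 0 := by
  classical
  have hpi := Real.pi_pos
  rw [independencePolynomial_eq_indepSum]
  have hC : 0 ≤ Real.cos φ := Real.cos_nonneg_of_neg_pi_div_two_le_of_le (by linarith [hφ.1]) hφ.2
  have hS : 0 ≤ Real.sin φ := Real.sin_nonneg_of_nonneg_of_le_pi hφ.1 (by linarith [hφ.2])
  have hα : 0 ≤ Real.arctan (r * Real.sin φ / (1 + r * Real.cos φ)) :=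
    Real.arctan_nonneg.2 (by positivity)
  have hβ : 0 ≤ Real.arctan r := Real.arctan_nonneg.2 hr
  refine (ratioBound_of_invariant (n := n) (U := polarSector r (-φ) (Real.pi / 2)) ?_ ?_ ?_ _).1
  · exact fun x hx => re_nonneg_of_mem_polarSector (by linarith [hφ.2]) le_rfl hx
  · intro s hs hsU
    have hz : (r * Complex.exp (θ * Complex.I) : ℂ) ∈ polarSector r θ θ :=
      ⟨r, θ, hr, le_rfl, le_rfl, le_rfl, rfl⟩
    have hprod := multiset_prod_mem_polarSector (s.map fun x => (1 + x)⁻¹)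
      (a := -Real.arctan r) (b := Real.arctan (r * Real.sin φ / (1 + r * Real.cos φ))) (by
        intro y hy
        obtain ⟨x, hx, rfl⟩ := Multiset.mem_map.1 hy
        exact inv_one_add_mem_polarSector hφ (hsU x hx))
    have h := mul_mem_polarSector hz hprod
    rw [mul_one, Multiset.card_map] at h
    -- Having fewer than `n` factors only narrows the angular range, because both extreme angles
    -- `hα` and `hβ` are nonnegative.
    have hsn : (s.card : ℝ) ≤ n := by exact_mod_cast hs
    refine polarSector_mono ?_ ?_ h
    · nlinarith
    · nlinarith
  · intro S v
    refine le_trans ?_ ((G.degree_le_maxDegree v).trans hG)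
    rw [← G.card_neighborFinset_eq_degree]
    refine Finset.card_le_card fun u hu => ?_
    simp only [Finset.mem_filter] at hu
    simpa using hu.2

theorem independencePolynomial_conj [Fintype V] [DecidableRel G.Adj] (z : ℂ) :
    independencePolynomial G (starRingEnd ℂ z) =
      starRingEnd ℂ (independencePolynomial G z) := by
  simp [independencePolynomial]

end Graph

/-! ### Zero-free half disks. -/

section ZeroFree

variable {V : Type*} [Fintype V] [DecidableEq V] {G : SimpleGraph V} [DecidableRel G.Adj]

/-- The coefficients are real, so zeros come in conjugate pairs and `arg z` may be replaced by its
absolute value. -/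
theorem independencePolynomial_ne_zero_of_abs_arg {n : ℕ} (hG : G.maxDegree ≤ n + 1) {z : ℂ}
    {φ : ℝ} (hφ : φ ∈ Set.Icc 0 (Real.pi / 2))
    (h1 : n * Real.arctan ‖z‖ - |z.arg| ≤ φ)
    (h2 : |z.arg| + n * Real.arctan (‖z‖ * Real.sin φ / (1 + ‖z‖ * Real.cos φ)) ≤ Real.pi / 2) :
    independencePolynomial G z ≠ 0 := by
  have h := independencePolynomial_ne_zero_of_angles hG (norm_nonneg z) hφ h1 h2
  rcases abs_choice z.arg with ha | ha
  · rwa [ha, Complex.norm_mul_exp_arg_mul_I] at h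
  · have e : (‖z‖ * Complex.exp (((|z.arg| : ℝ) : ℂ) * Complex.I) : ℂ) = starRingEnd ℂ z := by
      conv_rhs => rw [← Complex.norm_mul_exp_arg_mul_I z]
      rw [ha, map_mul, ← Complex.exp_conj, map_mul, Complex.conj_ofReal, Complex.conj_ofReal,
        Complex.conj_I]
      push_cast
      ring_nf
    rw [e, independencePolynomial_conj] at h
    exact fun h0 => h (by rw [h0, map_zero])

theorem mul_sin_div_mono {r s φ : ℝ} (hr : 0 ≤ r) (hrs : r ≤ s)
    (hφ : φ ∈ Set.Icc 0 (Real.pi / 2)) :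
    r * Real.sin φ / (1 + r * Real.cos φ) ≤ s * Real.sin φ / (1 + s * Real.cos φ) := by
  have hpi := Real.pi_pos
  have hC : 0 ≤ Real.cos φ := Real.cos_nonneg_of_neg_pi_div_two_le_of_le (by linarith [hφ.1]) hφ.2
  have hS : 0 ≤ Real.sin φ := Real.sin_nonneg_of_nonneg_of_le_pi hφ.1 (by linarith [hφ.2])
  have hs : 0 ≤ s := hr.trans hrs
  rw [div_le_div_iff₀ (by positivity) (by positivity)]
  nlinarith [mul_le_mul_of_nonneg_right hrs hS]

/-- Reduction of zero-freeness to an inequality for the extreme angles of `1 + R`. -/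
theorem independencePolynomial_ne_zero_of_forall {n : ℕ} (hG : G.maxDegree ≤ n + 1) {z : ℂ}
    (hz : 0 ≤ z.re) (hn : n * Real.arctan ‖z‖ ≤ Real.pi / 2)
    (h : ∀ φ ∈ Set.Icc 0 (Real.pi / 2), n * (Real.arctan ‖z‖ +
      Real.arctan (‖z‖ * Real.sin φ / (1 + ‖z‖ * Real.cos φ))) ≤ Real.pi / 2 + φ) :
    independencePolynomial G z ≠ 0 := by
  have harg := Complex.abs_arg_le_pi_div_two_iff.2 hz
  -- The least admissible `φ` is `n arctan ‖z‖ - |arg z|`, or `0` if this is negative; for `φ = 0`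
  -- the second angle condition reduces to `|arg z| ≤ π/2`.
  rcases le_total (n * Real.arctan ‖z‖) |z.arg| with hle | hle
  · refine independencePolynomial_ne_zero_of_abs_arg hG (φ := 0)
      ⟨le_rfl, by positivity⟩ (by linarith) (by simpa using harg)
  · have hφ : n * Real.arctan ‖z‖ - |z.arg| ∈ Set.Icc 0 (Real.pi / 2) :=
      ⟨by linarith, by linarith [abs_nonneg z.arg]⟩
    have := h _ hφ
    exact independencePolynomial_ne_zero_of_abs_arg hG hφ le_rfl (by linarith)

/-- At radius `1` the extreme angle is exactly `arg (1 + e^{iφ}) = φ / 2`, and smaller radii only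
decrease it. -/
theorem independencePolynomial_ne_zero_of_norm_le_one (hG : G.maxDegree ≤ 3) {z : ℂ}
    (hz : z ∈ rightHalfDisk 1) : independencePolynomial G z ≠ 0 := by
  have hpi := Real.pi_pos
  have hβ : Real.arctan ‖z‖ ≤ Real.pi / 4 := by
    rw [← Real.arctan_one]; exact Real.arctan_mono hz.2
  refine independencePolynomial_ne_zero_of_forall (n := 2) hG hz.1 (by push_cast; linarith) ?_
  intro φ hφ
  have hα : Real.arctan (‖z‖ * Real.sin φ / (1 + ‖z‖ * Real.cos φ)) ≤ φ / 2 := by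
    rw [← Real.arctan_tan (x := φ / 2) (by linarith [hφ.1]) (by linarith [hφ.2])]
    refine Real.arctan_mono ((mul_sin_div_mono (norm_nonneg z) hz.2 hφ).trans (le_of_eq ?_))
    have hc : 0 < Real.cos (φ / 2) :=
      Real.cos_pos_of_mem_Ioo ⟨by linarith [hφ.1], by linarith [hφ.2]⟩
    have e : φ = 2 * (φ / 2) := by ring
    have hs : Real.sin φ = 2 * Real.sin (φ / 2) * Real.cos (φ / 2) := by
      conv_lhs => rw [e, Real.sin_two_mul]
    have hcos : Real.cos φ = 2 * Real.cos (φ / 2) ^ 2 - 1 := by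
      conv_lhs => rw [e, Real.cos_two_mul]
    rw [hs, hcos, Real.tan_eq_sin_div_cos, one_mul, one_mul, add_sub_cancel]
    field_simp
  push_cast
  linarith

theorem independencePolynomial_ne_zero_of_norm_le_seven_eighths {n : ℕ} (hn : 2 ≤ n)
    (hG : G.maxDegree ≤ n + 1) {z : ℂ}
    (hz : z ∈ rightHalfDisk (7 / 8 * Real.tan (Real.pi / (2 * n)))) :
    independencePolynomial G z ≠ 0 := by
  have hpi := Real.pi_pos
  have hn' : (2 : ℝ) ≤ n := by exact_mod_cast hn
  have hx0 : 0 < Real.pi / (2 * n) := by positivity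
  have hx1 : Real.pi / (2 * n) ≤ Real.pi / 4 :=
    div_le_div_of_nonneg_left hpi.le (by norm_num) (by linarith)
  have hatan : Real.arctan (Real.tan (Real.pi / (2 * n))) = Real.pi / (2 * n) :=
    Real.arctan_tan (by linarith) (by linarith)
  have ht0 : 0 ≤ Real.tan (Real.pi / (2 * n)) :=
    Real.tan_nonneg_of_nonneg_of_le_pi_div_two hx0.le (by linarith)
  have ht1 : Real.tan (Real.pi / (2 * n)) ≤ 1 := by
    rw [← Real.arctan_le_arctan_iff, hatan, Real.arctan_one]; exact hx1
  have hxn : n * (Real.pi / (2 * n)) = Real.pi / 2 := by field_simp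
  set t := Real.tan (Real.pi / (2 * n))
  refine independencePolynomial_ne_zero_of_forall hG hz.1 ?_ ?_
  · have : Real.arctan ‖z‖ ≤ Real.arctan t := Real.arctan_mono (by linarith [hz.2])
    rw [hatan] at this
    calc (n : ℝ) * Real.arctan ‖z‖ ≤ n * (Real.pi / (2 * n)) := by gcongr
      _ = _ := hxn
  · intro φ hφ
    have h1 := arctan_add_arctan_le (c := 7 / 8) (by norm_num) (by norm_num) ht0 ht1 hφ
      (seven_eighths_mul_one_add_sin_le hφ.1)
    have h2 := Real.arctan_mono (mul_sin_div_mono (norm_nonneg z) hz.2 hφ)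
    have h3 := Real.arctan_mono hz.2
    rw [hatan] at h1
    calc n * (Real.arctan ‖z‖ +
          Real.arctan (‖z‖ * Real.sin φ / (1 + ‖z‖ * Real.cos φ)))
        ≤ n * ((1 + 2 * φ / Real.pi) * (Real.pi / (2 * n))) := by
          gcongr; linarith
      _ = (1 + 2 * φ / Real.pi) * (n * (Real.pi / (2 * n))) := by ring
      _ = Real.pi / 2 + φ := by rw [hxn]; field_simp

end ZeroFree

/-! ### The region and its topology. -/

/-- An open region of the right half plane that is star-shaped from the origin. -/
def starRegion (n : ℕ) (ρ : ℝ) : Set ℂ :=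
  {z : ℂ | 0 < z.re ∧ (‖z‖ < ρ ∨ |z.arg| + n * Real.arctan ‖z‖ < Real.pi / 2 ∨
    n * Real.arctan ‖z‖ < |z.arg|)}

/-- The closure of `starRegion n ρ`. -/
def closedStarRegion (n : ℕ) (ρ : ℝ) : Set ℂ :=
  {z : ℂ | 0 ≤ z.re ∧ (‖z‖ ≤ ρ ∨ |z.arg| + n * Real.arctan ‖z‖ ≤ Real.pi / 2 ∨
    n * Real.arctan ‖z‖ ≤ |z.arg|)}

open Filter Topology

theorem continuousAt_abs_arg_of_re_nonneg {z : ℂ} (hz : 0 ≤ z.re) (h0 : z ≠ 0) :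
    ContinuousAt (fun w : ℂ => |w.arg|) z := by
  refine (Complex.continuousAt_arg ?_).abs
  rw [Complex.mem_slitPlane_iff]
  rcases hz.lt_or_eq with h | h
  · exact Or.inl h
  · exact Or.inr fun him => h0 (Complex.ext h.symm him)

theorem continuous_mul_arctan_norm (n : ℕ) :
    Continuous (fun w : ℂ => (n : ℝ) * Real.arctan ‖w‖) :=
  continuous_const.mul (Real.continuous_arctan.comp continuous_norm)

/-- The conditions are open where `arg` is continuous; at the origin, where it is not, `‖w‖ < ρ`
takes over. -/
theorem eventually_starRegion_condition {n : ℕ} {ρ : ℝ} (hρ : 0 < ρ) {z : ℂ} (hz : 0 ≤ z.re)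
    (h : ‖z‖ < ρ ∨ |z.arg| + n * Real.arctan ‖z‖ < Real.pi / 2 ∨ n * Real.arctan ‖z‖ < |z.arg|) :
    ∀ᶠ w in 𝓝 z, ‖w‖ < ρ ∨ |w.arg| + n * Real.arctan ‖w‖ < Real.pi / 2 ∨
      n * Real.arctan ‖w‖ < |w.arg| := by
  have hnorm : ‖z‖ < ρ → ∀ᶠ w in 𝓝 z, ‖w‖ < ρ := fun h =>
    continuous_norm.continuousAt.eventually_lt continuousAt_const h
  rcases eq_or_ne z 0 with rfl | h0
  · exact (hnorm (by simpa using hρ)).mono fun w hw => Or.inl hw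
  have ha := continuousAt_abs_arg_of_re_nonneg hz h0
  have hc : ContinuousAt (fun w : ℂ => (n : ℝ) * Real.arctan ‖w‖) z :=
    (continuous_mul_arctan_norm n).continuousAt
  rcases h with h | h | h
  · exact (hnorm h).mono fun w hw => Or.inl hw
  · exact ((ha.add hc).eventually_lt continuousAt_const h).mono fun w hw => Or.inr (Or.inl hw)
  · exact (hc.eventually_lt ha h).mono fun w hw => Or.inr (Or.inr hw)

theorem isOpen_starRegion {n : ℕ} {ρ : ℝ} (hρ : 0 < ρ) : IsOpen (starRegion n ρ) := by
  rw [isOpen_iff_mem_nhds]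
  intro z hz
  exact (continuous_const.continuousAt.eventually_lt Complex.continuous_re.continuousAt hz.1).and
    (eventually_starRegion_condition hρ hz.1.le hz.2)

/-- Scaling by `s < 1` keeps the argument and strictly lowers the norm, so each weak inequality
becomes strict. -/
theorem smul_mem_starRegion_condition {n : ℕ} (hn : 0 < n) {ρ : ℝ} {z : ℂ} (h0 : z ≠ 0)
    (h : ‖z‖ ≤ ρ ∨ |z.arg| + n * Real.arctan ‖z‖ ≤ Real.pi / 2 ∨ n * Real.arctan ‖z‖ ≤ |z.arg|)
    {s : ℝ} (hs : s ∈ Set.Ioo 0 1) :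
    ‖s * z‖ < ρ ∨ |(s * z).arg| + n * Real.arctan ‖s * z‖ < Real.pi / 2 ∨
      n * Real.arctan ‖s * z‖ < |(s * z).arg| := by
  have hnorm : ‖s * z‖ < ‖z‖ := by
    rw [norm_mul, Complex.norm_real, Real.norm_of_nonneg hs.1.le]
    nlinarith [hs.2, norm_pos_iff.2 h0]
  have hn' : (0 : ℝ) < n := by exact_mod_cast hn
  have hlt : (n : ℝ) * Real.arctan ‖s * z‖ < n * Real.arctan ‖z‖ :=
    mul_lt_mul_of_pos_left (Real.arctan_strictMono hnorm) hn'
  rw [Complex.arg_real_mul z hs.1]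
  rcases h with h | h | h
  · exact Or.inl (by linarith)
  · exact Or.inr (Or.inl (by linarith))
  · exact Or.inr (Or.inr (by linarith))

theorem smul_mem_starRegion {n : ℕ} (hn : 0 < n) {ρ : ℝ} {z : ℂ} (hz : z ∈ starRegion n ρ)
    {s : ℝ} (hs : s ∈ Set.Ioc 0 1) : (s * z : ℂ) ∈ starRegion n ρ := by
  rcases hs.2.eq_or_lt with rfl | hs1
  · simpa using hz
  have h0 : z ≠ 0 := fun h => by simpa [h] using hz.1
  refine ⟨by rw [Complex.re_ofReal_mul]; exact mul_pos hs.1 hz.1, ?_⟩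
  exact smul_mem_starRegion_condition hn h0
    (hz.2.imp le_of_lt (Or.imp le_of_lt le_of_lt)) ⟨hs.1, hs1⟩

theorem mem_closure_starRegion {n : ℕ} {ρ : ℝ} (hρ : 0 < ρ) {z : ℂ} (hz : 0 ≤ z.re)
    (h : ‖z‖ < ρ ∨ |z.arg| + n * Real.arctan ‖z‖ < Real.pi / 2 ∨ n * Real.arctan ‖z‖ < |z.arg|) :
    z ∈ closure (starRegion n ρ) := by
  have hcl : z ∈ closure {w : ℂ | 0 < w.re} := by
    rw [Complex.closure_setOfPred_lt_re]; exact hz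
  rw [mem_closure_iff_frequently] at hcl ⊢
  exact hcl.and_eventually (eventually_starRegion_condition hρ hz h)

theorem closure_starRegion {n : ℕ} (hn : 0 < n) {ρ : ℝ} (hρ : 0 < ρ) :
    closure (starRegion n ρ) = closedStarRegion n ρ := by
  apply Set.Subset.antisymm
  · intro z hz
    have hre : 0 ≤ z.re := by
      have : z ∈ closure {w : ℂ | 0 < w.re} := closure_mono (fun w hw => hw.1) hz
      rwa [Complex.closure_setOfPred_lt_re] at this
    refine ⟨hre, ?_⟩
    -- If all three alternatives fail at `z`, they fail strictly, hence on a neighbourhood, which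
    -- must meet the open region.
    by_contra! hcon
    obtain ⟨h1, h2, h3⟩ := hcon
    have h0 : z ≠ 0 := by rintro rfl; simp at h1; linarith
    have ha := continuousAt_abs_arg_of_re_nonneg hre h0
    have hc : ContinuousAt (fun w : ℂ => (n : ℝ) * Real.arctan ‖w‖) z :=
      (continuous_mul_arctan_norm n).continuousAt
    have e1 : ∀ᶠ w : ℂ in 𝓝 z, ρ < ‖w‖ :=
      continuousAt_const.eventually_lt continuous_norm.continuousAt h1
    have e2 := continuousAt_const.eventually_lt (ha.add hc) h2
    have e3 := ha.eventually_lt hc h3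
    rw [mem_closure_iff_frequently] at hz
    obtain ⟨w, hw, hw1, hw2, hw3⟩ := (hz.and_eventually (e1.and (e2.and e3))).exists
    have hw2' : Real.pi / 2 < |w.arg| + n * Real.arctan ‖w‖ := hw2
    rcases hw.2 with h | h | h <;> linarith
  · intro z hz
    rcases eq_or_ne z 0 with rfl | h0
    · exact mem_closure_starRegion hρ le_rfl (Or.inl (by simpa using hρ))
    -- Two limits are needed: radial scaling makes the inequalities strict, and the points `s z`,
    -- which may lie on the imaginary axis, are then approached from `Re > 0`.
    rw [← closure_closure]
    have hlim : Tendsto (fun s : ℝ => (s : ℂ) * z) (𝓝[<] 1) (𝓝 z) := by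
      have : ContinuousAt (fun s : ℝ => (s : ℂ) * z) 1 := by fun_prop
      simpa using this.tendsto.mono_left nhdsWithin_le_nhds
    refine mem_closure_of_tendsto hlim ?_
    filter_upwards [Ioo_mem_nhdsLT (zero_lt_one' ℝ)] with s hs
    refine mem_closure_starRegion hρ ?_ (smul_mem_starRegion_condition hn h0 hz.2 hs)
    rw [Complex.re_ofReal_mul]
    exact mul_nonneg hs.1.le hz.1

theorem isConnected_starRegion {n : ℕ} (hn : 0 < n) {ρ : ℝ} (hρ : 0 < ρ) :
    IsConnected (starRegion n ρ) := by
  let H : Set ℂ := {w : ℂ | 0 < w.re} ∩ Metric.ball 0 ρ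
  have hH : IsPreconnected H :=
    ((convex_halfSpace_re_gt 0).inter (convex_ball 0 ρ)).isPreconnected
  have hHsub : H ⊆ starRegion n ρ := fun w hw => ⟨hw.1, Or.inl (by simpa using hw.2)⟩
  have hx : ((ρ / 2 : ℝ) : ℂ) ∈ H := by
    refine ⟨by simpa using hρ, ?_⟩
    rw [mem_ball_zero_iff, Complex.norm_real, Real.norm_of_nonneg (by positivity)]
    linarith
  refine ⟨⟨_, hHsub hx⟩, isPreconnected_of_forall ((ρ / 2 : ℝ) : ℂ) fun y hy => ?_⟩
  have hy0 : 0 < ‖y‖ := norm_pos_iff.2 fun h => by simpa [h] using hy.1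
  -- Each point is joined by its radial segment to the convex half ball `H`.
  refine ⟨H ∪ (fun s : ℝ => (s * y : ℂ)) '' Set.Ioc 0 1, ?_, Or.inl hx,
    Or.inr ⟨1, by simp, by simp⟩, ?_⟩
  · refine Set.union_subset hHsub ?_
    rintro _ ⟨s, hs, rfl⟩
    exact smul_mem_starRegion hn hy hs
  · have hs : min 1 (ρ / (2 * ‖y‖)) ∈ Set.Ioc (0 : ℝ) 1 :=
      ⟨lt_min one_pos (by positivity), min_le_left _ _⟩
    refine hH.union' ⟨(min 1 (ρ / (2 * ‖y‖)) : ℝ) * y, ⟨?_, ?_⟩, ⟨_, hs, rfl⟩⟩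
      (isPreconnected_Ioc.image _ (by fun_prop))
    · rw [Set.mem_ofPred_eq]
      rw [Complex.re_ofReal_mul]
      exact mul_pos hs.1 hy.1
    · rw [mem_ball_zero_iff, norm_mul, Complex.norm_real, Real.norm_of_nonneg hs.1.le]
      calc min 1 (ρ / (2 * ‖y‖)) * ‖y‖ ≤ ρ / (2 * ‖y‖) * ‖y‖ := by
            gcongr; exact min_le_right _ _
        _ = ρ / 2 := by field_simp
        _ < ρ := by linarith

theorem closedStarRegion_eq_closure_interior {n : ℕ} (hn : 0 < n) {ρ : ℝ} (hρ : 0 < ρ) :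
    closedStarRegion n ρ = closure (interior (closedStarRegion n ρ)) := by
  rw [← closure_starRegion hn hρ]
  apply Set.Subset.antisymm
  · exact closure_mono (interior_maximal subset_closure (isOpen_starRegion hρ))
  · exact closure_minimal interior_subset isClosed_closure

theorem isConnected_interior_closedStarRegion {n : ℕ} (hn : 0 < n) {ρ : ℝ} (hρ : 0 < ρ) :
    IsConnected (interior (closedStarRegion n ρ)) := by
  rw [← closure_starRegion hn hρ]
  exact (isConnected_starRegion hn hρ).subset_closure
    (interior_maximal subset_closure (isOpen_starRegion hρ)) interior_subset

/-! ### Zero-freeness and inclusions for the region. -/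

/-- The last two alternatives are the angle criterion at `φ = π/2`, where both extreme angles equal
`arctan ‖z‖`, and at `φ = 0`, where the upper one vanishes. -/
theorem independencePolynomial_ne_zero_of_mem_closedStarRegion {V : Type*} [Fintype V]
    [DecidableEq V] {G : SimpleGraph V} [DecidableRel G.Adj] {n : ℕ} (hn : 2 ≤ n)
    (hG : G.maxDegree ≤ n + 1) {z : ℂ}
    (hz : z ∈ closedStarRegion n (7 / 8 * Real.tan (Real.pi / (2 * n)))) :
    independencePolynomial G z ≠ 0 := by
  have harg := Complex.abs_arg_le_pi_div_two_iff.2 hz.1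
  have hpi := Real.pi_pos
  rcases hz.2 with h | h | h
  · exact independencePolynomial_ne_zero_of_norm_le_seven_eighths hn hG ⟨hz.1, h⟩
  · refine independencePolynomial_ne_zero_of_abs_arg hG (φ := Real.pi / 2)
      ⟨by positivity, le_rfl⟩ (by linarith [abs_nonneg z.arg]) (by simpa using h)
  · refine independencePolynomial_ne_zero_of_abs_arg hG (φ := 0)
      ⟨le_rfl, by positivity⟩ (by linarith) (by simpa using harg)

theorem closedStarRegion_subset_rightHalfDisk {n : ℕ} (hn : 2 ≤ n) :
    closedStarRegion n (7 / 8 * Real.tan (Real.pi / (2 * n))) ⊆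
      rightHalfDisk (Real.tan (Real.pi / (2 * n))) := by
  have hpi := Real.pi_pos
  have hn' : (2 : ℝ) ≤ n := by exact_mod_cast hn
  have hx0 : 0 < Real.pi / (2 * n) := by positivity
  have hx1 : Real.pi / (2 * n) ≤ Real.pi / 4 :=
    div_le_div_of_nonneg_left hpi.le (by norm_num) (by linarith)
  have ht0 : 0 ≤ Real.tan (Real.pi / (2 * n)) :=
    Real.tan_nonneg_of_nonneg_of_le_pi_div_two hx0.le (by linarith)
  intro z hz
  have harg := Complex.abs_arg_le_pi_div_two_iff.2 hz.1
  refine ⟨hz.1, ?_⟩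
  have key : n * Real.arctan ‖z‖ ≤ Real.pi / 2 → ‖z‖ ≤ Real.tan (Real.pi / (2 * n)) := by
    intro h
    rw [← Real.arctan_le_arctan_iff, Real.arctan_tan (by linarith) (by linarith),
      le_div_iff₀ (by positivity)]
    linarith
  rcases hz.2 with h | h | h
  · linarith
  · exact key (by linarith [abs_nonneg z.arg])
  · exact key (h.trans harg)

/-- The sector bounds read `|arg z| ≤ π/2 - π/(2 + ε)` and `n arctan ‖z‖ ≤ π/(2 + ε)`, and they add
up to the second alternative. -/
theorem petersRegtsRegion_subset_closedStarRegion {n : ℕ} (hn : 2 ≤ n) (ρ : ℝ) :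
    petersRegtsRegion (n + 1) ⊆ closedStarRegion n ρ := by
  have hpi := Real.pi_pos
  have hn' : (2 : ℝ) ≤ n := by exact_mod_cast hn
  intro z hz
  obtain ⟨⟨ε, hε⟩, hz⟩ := Set.mem_iUnion.1 hz
  obtain ⟨h1, h2⟩ := hz
  simp only [Nat.cast_add, Nat.cast_one, add_sub_cancel_right] at h1 h2
  have h2' : |z.arg| ≤ Real.pi / 2 - Real.pi / (2 + ε) := by
    convert h2 using 1
    field_simp
    ring
  have hx0 : 0 < Real.pi / ((2 + ε) * n) := by positivity
  have hx1 : Real.pi / ((2 + ε) * n) ≤ Real.pi / 4 :=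
    div_le_div_of_nonneg_left hpi.le (by norm_num) (by nlinarith)
  have h1' : n * Real.arctan ‖z‖ ≤ Real.pi / (2 + ε) := by
    have := Real.arctan_mono h1
    rw [Real.arctan_tan (by linarith) (by linarith)] at this
    calc n * Real.arctan ‖z‖ ≤ n * (Real.pi / ((2 + ε) * n)) := by gcongr
      _ = _ := by field_simp
  have h3 : 0 < Real.pi / (2 + ε) := by positivity
  exact ⟨Complex.abs_arg_le_pi_div_two_iff.1 (by linarith), Or.inr (Or.inl (by linarith))⟩

/-- Every sector has half-angle strictly below `π/2`. -/
theorem I_mul_ofReal_notMem_petersRegtsRegion {Δ : ℕ} {t : ℝ} (ht : 0 < t) :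
    Complex.I * (t : ℂ) ∉ petersRegtsRegion Δ := by
  intro hz
  obtain ⟨⟨ε, hε⟩, hz⟩ := Set.mem_iUnion.1 hz
  have h2 := hz.2
  simp only at h2
  have h3 : ε * Real.pi / (2 * (2 + ε)) < Real.pi / 2 := by
    rw [div_lt_div_iff₀ (by positivity) (by norm_num)]
    nlinarith [Real.pi_pos]
  rw [mul_comm, Complex.arg_real_mul _ ht, Complex.arg_I,
    abs_of_pos (by positivity : 0 < Real.pi / 2)] at h2
  linarith

theorem theorem3 :
    (∀ (V : Type*) [Fintype V] [DecidableEq V] (G : SimpleGraph V) [DecidableRel G.Adj],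
      G.maxDegree ≤ 3 → ∀ z ∈ rightHalfDisk 1, independencePolynomial G z ≠ 0) ∧
    (∀ Δ : ℕ, 3 ≤ Δ → ∃ D : Set ℂ,
      IsConnected (interior D) ∧ D = closure (interior D) ∧
      (∀ (V : Type*) [Fintype V] [DecidableEq V] (G : SimpleGraph V) [DecidableRel G.Adj],
        G.maxDegree ≤ Δ → ∀ z ∈ D, independencePolynomial G z ≠ 0) ∧
      rightHalfDisk (7 / 8 * tanRadius Δ) ⊆ D ∧
      D ⊆ rightHalfDisk (tanRadius Δ) ∧
      petersRegtsRegion Δ ⊂ D ∧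
      (tanRadius Δ : ℂ) ∈ D ∧
      Complex.I * (tanRadius Δ : ℂ) ∈ D ∧
      -(Complex.I * (tanRadius Δ : ℂ)) ∈ D) := by
  refine ⟨fun V _ _ G _ hG z hz => independencePolynomial_ne_zero_of_norm_le_one hG hz, ?_⟩
  intro Δ hΔ
  -- Here `n = Δ - 1` is the number of neighbours left to a vertex once one has been removed.
  obtain ⟨n, rfl⟩ : ∃ n, Δ = n + 1 := ⟨Δ - 1, by omega⟩
  have hn : 2 ≤ n := by omega
  have hpi := Real.pi_pos
  have hn' : (2 : ℝ) ≤ n := by exact_mod_cast hn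
  have hτ : tanRadius (n + 1) = Real.tan (Real.pi / (2 * n)) := by simp [tanRadius]
  have hx0 : 0 < Real.pi / (2 * n) := by positivity
  have hx1 : Real.pi / (2 * n) ≤ Real.pi / 4 :=
    div_le_div_of_nonneg_left hpi.le (by norm_num) (by linarith)
  have ht0 : 0 < Real.tan (Real.pi / (2 * n)) :=
    Real.tan_pos_of_pos_of_lt_pi_div_two hx0 (by linarith)
  have hatan : n * Real.arctan (Real.tan (Real.pi / (2 * n))) = Real.pi / 2 := by
    rw [Real.arctan_tan (by linarith) (by linarith)]
    field_simp
  rw [hτ]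
  set τ := Real.tan (Real.pi / (2 * n))
  have hρ : 0 < 7 / 8 * τ := by positivity
  have hargI : (Complex.I * (τ : ℂ)).arg = Real.pi / 2 := by
    rw [mul_comm, Complex.arg_real_mul _ ht0, Complex.arg_I]
  have hargnegI : (-(Complex.I * (τ : ℂ))).arg = -(Real.pi / 2) := by
    rw [mul_comm, ← mul_neg, Complex.arg_real_mul _ ht0, Complex.arg_neg_I]
  have hnormI : ‖Complex.I * (τ : ℂ)‖ = τ := by
    rw [norm_mul, Complex.norm_I, one_mul, Complex.norm_real, Real.norm_of_nonneg ht0.le]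
  -- Since `n arctan τ = π/2`, the points `±iτ` satisfy the third alternative with equality, and `τ`
  -- the second.
  have hI : Complex.I * (τ : ℂ) ∈ closedStarRegion n (7 / 8 * τ) := by
    refine ⟨by simp, Or.inr (Or.inr ?_)⟩
    rw [hnormI, hargI, hatan]
    exact le_abs_self _
  refine ⟨closedStarRegion n (7 / 8 * τ),
    isConnected_interior_closedStarRegion (by omega) hρ,
    closedStarRegion_eq_closure_interior (by omega) hρ,
    fun V _ _ G _ hG z hz => independencePolynomial_ne_zero_of_mem_closedStarRegion hn hG hz,
    fun z hz => ⟨hz.1, Or.inl hz.2⟩, closedStarRegion_subset_rightHalfDisk hn,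
    (Set.ssubset_iff_of_subset (petersRegtsRegion_subset_closedStarRegion hn _)).2
      ⟨_, hI, I_mul_ofReal_notMem_petersRegtsRegion ht0⟩, ?_, hI, ?_⟩
  · refine ⟨by simpa using ht0.le, Or.inr (Or.inl ?_)⟩
    rw [Complex.arg_ofReal_of_nonneg ht0.le, Complex.norm_real, Real.norm_of_nonneg ht0.le, hatan]
    simp
  · refine ⟨by simp, Or.inr (Or.inr ?_)⟩
    rw [norm_neg, hnormI, hargnegI, hatan, abs_neg]
    exact le_abs_self _
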